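/- Let $V$ be a valuation domain of rank one (that is, of Krull dimension one) with quotient field $K$ and associated valuation $v$. A sequence $E=\{s_n\}_{n\in\mathbb{N}}$ in $K$ is called pseudo-convergent if $v(s_{n+1}-s_n)<v(s_{n+2}-s_{n+1})$ for all $n\in\mathbb{N}$; for such a sequence, the set $$V_E=\{\phi\in K(X)\mid \phi(s_n)\in V\text{ for all but finitely many }n\in\mathbb{N}\}$$ is a valuation domain of $K(X)$ containing $V$. Let $\mathrm{Zar}(K(X)|V)$ be the set of all valuation domains of $K(X)$ containing $V$, endowed with the Zariski topology, i.e., the topology generated by the sets $B(\phi)=\{W\mid \phi\in W\}$ for $\phi\in K(X)$, and let $\mathcal{V}\subseteq\mathrm{Zar}(K(X)|V)$ be the set of all the $V_E$, as $E$ varies among the pseudo-convergent sequences in $K$, endowed with the subspace topology. If $V$ is countable, then $\mathcal{V}$ is second countable, regular (every point is closed, and every point can be separated by disjoint open sets from any closed set not containing it) and metrizable. -/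

import Mathlib

open Filter Polynomial

namespace PseudoConv

universe u w

/-- The Zariski space `Zar(L|D)`: the valuation domains of the field `L` containing `D`. -/
def Zar (D : Type u) (L : Type w) [CommRing D] [Field L] [Algebra D L] : Type w :=
  {W : ValuationSubring L // ∀ d : D, algebraMap D L d ∈ W}

/-- The Zariski topology, generated by the sets `B(φ) = {W | φ ∈ W}`, for `φ ∈ L`. -/
instance Zar.instTopologicalSpace (D : Type u) (L : Type w) [CommRing D] [Field L] [Algebra D L] :
    TopologicalSpace (Zar D L) :=
  TopologicalSpace.generateFrom (Set.range fun φ : L => {W : Zar D L | φ ∈ W.1})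

/-- Pseudo-convergent sequences for a valuation written multiplicatively: the usual (additive)
condition `v (s (n+1) - s n) < v (s (n+2) - s (n+1))` has its inequality reversed. -/
def IsPseudoConvergent {K : Type*} [Field K] {Γ : Type*} [LinearOrderedCommGroupWithZero Γ]
    (v : Valuation K Γ) (s : ℕ → K) : Prop :=
  ∀ n, v (s (n + 2) - s (n + 1)) < v (s (n + 1) - s n)

section Values

variable {L : Type*} [Field L] {Γ : Type*} [LinearOrderedCommGroupWithZero Γ]
  {w : Valuation L Γ} {s : ℕ → L}

theorem IsPseudoConvergent.strictAnti (hs : IsPseudoConvergent w s) :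
    StrictAnti fun n => w (s (n + 1) - s n) :=
  strictAnti_nat_of_succ_lt hs

theorem IsPseudoConvergent.gauge_pos (hs : IsPseudoConvergent w s) (n : ℕ) :
    0 < w (s (n + 1) - s n) :=
  lt_of_le_of_lt zero_le (hs n)

theorem IsPseudoConvergent.val_sub (hs : IsPseudoConvergent w s) (n k : ℕ) :
    w (s (n + 1 + k) - s n) = w (s (n + 1) - s n) := by
  induction k with
  | zero => rfl
  | succ k ih =>
    have h : s (n + 1 + (k + 1)) - s n
        = (s (n + 1 + k + 1) - s (n + 1 + k)) + (s (n + 1 + k) - s n) := by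
      rw [← add_assoc]; ring
    have hlt : w (s (n + 1 + k + 1) - s (n + 1 + k)) < w (s (n + 1 + k) - s n) := by
      rw [ih]
      exact hs.strictAnti (by omega)
    rw [h, Valuation.map_add_eq_of_lt_right _ hlt, ih]

theorem IsPseudoConvergent.val_sub_const (hs : IsPseudoConvergent w s) (β : L) :
    ∃ c : Γ, c ≠ 0 ∧ ∃ k : ℕ, ∀ᶠ n in atTop, w (s n - β) = c * w (s (n + 1) - s n) ^ k := by
  by_cases h : ∃ N, w (s (N + 1) - s N) < w (s N - β)
  · obtain ⟨N, hN⟩ := h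
    refine ⟨w (s N - β), (lt_of_le_of_lt zero_le hN).ne', 0, ?_⟩
    filter_upwards [eventually_ge_atTop (N + 1)] with n hn
    obtain ⟨k, rfl⟩ := Nat.exists_eq_add_of_le hn
    have e : s (N + 1 + k) - β = (s (N + 1 + k) - s N) + (s N - β) := by ring
    rw [e, Valuation.map_add_eq_of_lt_right _ (by rwa [hs.val_sub]), pow_zero, mul_one]
  · push Not at h
    refine ⟨1, one_ne_zero, 1, Eventually.of_forall fun n => ?_⟩
    have e : s n - β = (s n - s (n + 1)) + (s (n + 1) - β) := by ring
    have hlt : w (s (n + 1) - β) < w (s n - s (n + 1)) := by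
      rw [Valuation.map_sub_swap w (s n)]
      exact lt_of_le_of_lt (h (n + 1)) (hs n)
    rw [e, Valuation.map_add_eq_of_lt_left _ hlt, one_mul, pow_one, Valuation.map_sub_swap]

theorem IsPseudoConvergent.val_eval [IsAlgClosed L] (hs : IsPseudoConvergent w s) {f : L[X]}
    (hf : f ≠ 0) :
    ∃ c : Γ, c ≠ 0 ∧ ∃ k : ℕ, ∀ᶠ n in atTop, w (f.eval (s n)) = c * w (s (n + 1) - s n) ^ k := by
  have key : ∀ m : Multiset L, ∃ c : Γ, c ≠ 0 ∧ ∃ k : ℕ, ∀ᶠ n in atTop,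
      w ((m.map fun a => s n - a).prod) = c * w (s (n + 1) - s n) ^ k := by
    intro m
    induction m using Multiset.induction with
    | empty => exact ⟨1, one_ne_zero, 0, by simp⟩
    | cons a m ih =>
      obtain ⟨c, hc, k, h⟩ := ih
      obtain ⟨c', hc', k', h'⟩ := hs.val_sub_const a
      refine ⟨c' * c, mul_ne_zero hc' hc, k' + k, ?_⟩
      filter_upwards [h, h'] with n h1 h2
      rw [Multiset.map_cons, Multiset.prod_cons, map_mul, h1, h2, pow_add]
      exact mul_mul_mul_comm _ _ _ _
  obtain ⟨c, hc, k, h⟩ := key f.roots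
  refine ⟨w f.leadingCoeff * c, mul_ne_zero ?_ hc, k, ?_⟩
  · simpa using hf
  · filter_upwards [h] with n hn
    rw [(IsAlgClosed.splits f).eval_eq_prod_roots, map_mul, hn, mul_assoc]

theorem le_or_le_of_pow {d : ℕ → Γ} (hd : StrictAnti d) {c c' : Γ}
    {k l : ℕ} (hkl : l ≤ k) :
    (∀ᶠ n in atTop, c * d n ^ k ≤ c' * d n ^ l) ∨ ∀ᶠ n in atTop, c' * d n ^ l ≤ c * d n ^ k := by
  obtain ⟨j, rfl⟩ := Nat.exists_eq_add_of_le hkl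
  have e : ∀ n, c * d n ^ (l + j) = c * d n ^ j * d n ^ l := fun n => by
    rw [pow_add, mul_assoc, mul_comm (d n ^ l)]
  by_cases h : ∃ N, c * d N ^ j ≤ c'
  · obtain ⟨N, hN⟩ := h
    left
    filter_upwards [eventually_ge_atTop N] with n hn
    rw [e]
    refine mul_le_mul_left (le_trans (mul_le_mul_right ?_ c) hN) _
    exact pow_le_pow_left' (hd.antitone hn) j
  · push Not at h
    right
    refine Eventually.of_forall fun n => ?_
    rw [e]
    exact mul_le_mul_left (h n).le _

theorem IsPseudoConvergent.le_or_le [IsAlgClosed L] (hs : IsPseudoConvergent w s) {f g : L[X]}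
    (hf : f ≠ 0) (hg : g ≠ 0) :
    (∀ᶠ n in atTop, w (f.eval (s n)) ≤ w (g.eval (s n))) ∨
      ∀ᶠ n in atTop, w (g.eval (s n)) ≤ w (f.eval (s n)) := by
  obtain ⟨c, -, k, h⟩ := hs.val_eval hf
  obtain ⟨c', -, l, h'⟩ := hs.val_eval hg
  have : (∀ᶠ n in atTop, c * w (s (n + 1) - s n) ^ k ≤ c' * w (s (n + 1) - s n) ^ l) ∨
      ∀ᶠ n in atTop, c' * w (s (n + 1) - s n) ^ l ≤ c * w (s (n + 1) - s n) ^ k := by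
    rcases le_total l k with hkl | hkl
    · exact le_or_le_of_pow hs.strictAnti hkl
    · exact (le_or_le_of_pow hs.strictAnti hkl).symm
  refine this.imp (fun H => ?_) (fun H => ?_) <;>
  · filter_upwards [H, h, h'] with n h1 h2 h3
    rwa [h2, h3]

end Values

section ValueIn

variable {V : Type u} {K : Type w} [CommRing V] [Field K] [Algebra V K]

theorem eval_denom_ne_zero_of_dvd {K : Type w} [Field K] {p : K[X]} {φ : RatFunc K} (h : φ.denom ∣ p) {x : K}
    (hx : p.eval x ≠ 0) : φ.denom.eval x ≠ 0 := by
  obtain ⟨q, rfl⟩ := h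
  rw [Polynomial.eval_mul] at hx
  exact left_ne_zero_of_mul hx

/-- `φ(x) ∈ V`: the rational function `φ` is defined at `x`, with value in `V`. -/
def ValueIn (V : Type u) {K : Type w} [CommRing V] [Field K] [Algebra V K]
    (φ : RatFunc K) (x : K) : Prop :=
  φ.denom.eval x ≠ 0 ∧ ∃ a : V, algebraMap V K a = φ.eval (RingHom.id K) x

theorem ValueIn.mul {φ ψ : RatFunc K} {x : K} (h : ValueIn V φ x) (h' : ValueIn V ψ x) :
    ValueIn V (φ * ψ) x := by
  obtain ⟨h1, a, ha⟩ := h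
  obtain ⟨h2, b, hb⟩ := h'
  refine ⟨eval_denom_ne_zero_of_dvd (RatFunc.denom_mul_dvd φ ψ)
    (by rw [Polynomial.eval_mul]; exact mul_ne_zero h1 h2), a * b, ?_⟩
  rw [RatFunc.eval_mul (RingHom.id K) x h1 h2, map_mul, ha, hb]

theorem ValueIn.add {φ ψ : RatFunc K} {x : K} (h : ValueIn V φ x) (h' : ValueIn V ψ x) :
    ValueIn V (φ + ψ) x := by
  obtain ⟨h1, a, ha⟩ := h
  obtain ⟨h2, b, hb⟩ := h'
  refine ⟨eval_denom_ne_zero_of_dvd (RatFunc.denom_add_dvd φ ψ)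
    (by rw [Polynomial.eval_mul]; exact mul_ne_zero h1 h2), a + b, ?_⟩
  rw [RatFunc.eval_add (RingHom.id K) x h1 h2, map_add, ha, hb]

theorem valueIn_algebraMap (a : V) (x : K) : ValueIn V (RatFunc.C (algebraMap V K a)) x :=
  ⟨by simp, a, by simp [RatFunc.eval_C]⟩

end ValueIn

section Ring

variable (V : Type u) {K : Type w} [CommRing V] [IsDomain V] [ValuationRing V] [Field K]
  [Algebra V K] [IsFractionRing V K]

/-- A valuation ring extends to every field containing its quotient field. -/
theorem exists_extension (L : Type*) [Field L] [Algebra K L] :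
    ∃ W : ValuationSubring L, ∀ x y : K,
      ValuationRing.valuation V K x ≤ ValuationRing.valuation V K y ↔
        W.valuation (algebraMap K L x) ≤ W.valuation (algebraMap K L y) := by
  let f : V →+* L := (algebraMap K L).comp (algebraMap V K)
  have hf : Function.Injective f :=
    (algebraMap K L).injective.comp (IsFractionRing.injective V K)
  obtain ⟨W, hle, hloc⟩ := (LocalSubring.range f).exists_le_valuationSubring
  have hmem : ∀ a : V, f a ∈ W := fun a => hle ⟨a, rfl⟩
  refine ⟨W, ?_⟩
  have hval : ∀ x : K, ValuationRing.valuation V K x ≤ 1 ↔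
      (W.valuation.comap (algebraMap K L)) x ≤ 1 := by
    intro x
    rw [Valuation.comap_apply, ValuationSubring.valuation_le_one_iff, ← Valuation.mem_integer_iff,
      ValuationRing.mem_integer_iff]
    constructor
    · rintro ⟨a, rfl⟩
      exact hmem a
    · intro hx
      rcases ValuationRing.isInteger_or_isInteger V x with h | ⟨a, ha⟩
      · exact h
      · by_cases hx0 : x = 0
        · exact ⟨0, by simp [hx0]⟩
        have hfa : f a = (algebraMap K L x)⁻¹ := by
          change algebraMap K L (algebraMap V K a) = _
          rw [ha, map_inv₀]
        let a' : (LocalSubring.range f).toSubring := ⟨f a, ⟨a, rfl⟩⟩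
        have hu : IsUnit (Subring.inclusion hle a') := by
          refine IsUnit.of_mul_eq_one (⟨algebraMap K L x, hx⟩ : W.toLocalSubring.toSubring) ?_
          apply Subtype.ext
          change f a * algebraMap K L x = 1
          rw [hfa, inv_mul_cancel₀]
          simpa using hx0
        obtain ⟨⟨_, b, rfl⟩, hb⟩ := isUnit_iff_exists_inv.mp (hloc.map_nonunit a' hu)
        refine ⟨b, (algebraMap K L).injective ?_⟩
        have hb' : f a * f b = 1 := congrArg Subtype.val hb
        change f b = _
        rw [hfa] at hb'
        rw [eq_comm, ← mul_one (algebraMap K L x), ← hb', mul_inv_cancel_left₀]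
        simpa using hx0
  exact fun x y => Valuation.isEquiv_of_val_le_one (fun x => hval x) x y

variable {V}

theorem IsPseudoConvergent.eventually_ne_zero {s : ℕ → K}
    (hs : IsPseudoConvergent (ValuationRing.valuation V K) s) {f : K[X]} (hf : f ≠ 0) :
    ∀ᶠ n in atTop, f.eval (s n) ≠ 0 := by
  have hinj : Function.Injective s := by
    have h : ∀ m n, m < n → s m ≠ s n := by
      intro m n hmn e
      obtain ⟨k, rfl⟩ := Nat.exists_eq_add_of_le (Nat.succ_le_of_lt hmn)
      have h1 := hs.val_sub m k
      have h2 := hs.gauge_pos m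
      rw [← h1] at h2
      simp [e] at h2
    intro m n e
    rcases lt_trichotomy m n with hmn | hmn | hmn
    · exact absurd e (h _ _ hmn)
    · exact hmn
    · exact absurd e.symm (h _ _ hmn)
  have hfin : {n | f.eval (s n) = 0}.Finite :=
    ((f.rootSet_finite K).preimage hinj.injOn).subset fun n hn => by
      simpa [Polynomial.mem_rootSet, hf] using hn
  rw [← Nat.cofinite_eq_atTop]
  exact hfin.compl_mem_cofinite

theorem IsPseudoConvergent.eval_le_or_le {s : ℕ → K}
    (hs : IsPseudoConvergent (ValuationRing.valuation V K) s) {f g : K[X]}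
    (hf : f ≠ 0) (hg : g ≠ 0) :
    (∀ᶠ n in atTop, ValuationRing.valuation V K (f.eval (s n)) ≤
        ValuationRing.valuation V K (g.eval (s n))) ∨
      ∀ᶠ n in atTop, ValuationRing.valuation V K (g.eval (s n)) ≤
        ValuationRing.valuation V K (f.eval (s n)) := by
  obtain ⟨W, hW⟩ := exists_extension V (K := K) (AlgebraicClosure K)
  let ι := algebraMap K (AlgebraicClosure K)
  have hs' : IsPseudoConvergent W.valuation (fun n => ι (s n)) := by
    intro n
    have := hs n
    rw [← not_le, hW, not_le] at this
    simpa only [map_sub] using this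
  have := hs'.le_or_le (f := f.map ι) (g := g.map ι)
    ((Polynomial.map_ne_zero_iff ι.injective).2 hf) ((Polynomial.map_ne_zero_iff ι.injective).2 hg)
  simpa only [hW, Polynomial.eval_map_apply] using this

theorem valueIn_iff {φ : RatFunc K} {x : K} (h : φ.denom.eval x ≠ 0) :
    ValueIn V φ x ↔ ValuationRing.valuation V K (φ.num.eval x) ≤
      ValuationRing.valuation V K (φ.denom.eval x) := by
  have : ValueIn V φ x ↔ ValuationRing.valuation V K (φ.eval (RingHom.id K) x) ≤ 1 := by
    rw [← Valuation.mem_integer_iff, ValuationRing.mem_integer_iff]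
    exact and_iff_right h
  rw [this, RatFunc.eval, ← Polynomial.eval, ← Polynomial.eval, map_div₀]
  exact div_le_one₀ (zero_lt_iff.2 ((Valuation.ne_zero_iff _).2 h))

theorem valueIn_inv {φ : RatFunc K} {x : K} (hn : φ.num.eval x ≠ 0) (hd : φ.denom.eval x ≠ 0)
    (h : ValuationRing.valuation V K (φ.denom.eval x) ≤
      ValuationRing.valuation V K (φ.num.eval x)) : ValueIn V φ⁻¹ x := by
  have hφ : φ ≠ 0 := by
    rintro rfl
    simp at hn
  have hd' : φ⁻¹.denom.eval x ≠ 0 := eval_denom_ne_zero_of_dvd (RatFunc.denom_inv_dvd hφ) hn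
  refine ⟨hd', ?_⟩
  have hmul := RatFunc.eval_mul (f := RingHom.id K) (a := x) hd hd'
  rw [mul_inv_cancel₀ hφ, RatFunc.eval_one] at hmul
  rw [← ValuationRing.mem_integer_iff, Valuation.mem_integer_iff, eq_inv_of_mul_eq_one_right hmul.symm,
    map_inv₀]
  refine inv_le_one_of_one_le₀ ?_
  rw [RatFunc.eval, ← Polynomial.eval, ← Polynomial.eval, map_div₀]
  exact (one_le_div₀ (zero_lt_iff.2 ((Valuation.ne_zero_iff _).2 hd))).2 h

/-- The valuation domain `V_E = {φ ∈ K(X) | φ(s n) ∈ V for all but finitely many n}` of a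
pseudo-convergent sequence `E = (s n)` in `K`. -/
def VE (V : Type u) {K : Type w} [CommRing V] [IsDomain V] [ValuationRing V] [Field K]
    [Algebra V K] [IsFractionRing V K] (s : ℕ → K)
    (hs : IsPseudoConvergent (ValuationRing.valuation V K) s) : ValuationSubring (RatFunc K) where
  carrier := {φ | ∀ᶠ n in atTop, ValueIn V φ (s n)}
  mul_mem' ha hb := by filter_upwards [ha, hb] with n h1 h2 using h1.mul h2
  add_mem' ha hb := by filter_upwards [ha, hb] with n h1 h2 using h1.add h2
  one_mem' := Eventually.of_forall fun n => by simpa using valueIn_algebraMap (1 : V) (s n)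
  zero_mem' := Eventually.of_forall fun n => by simpa using valueIn_algebraMap (0 : V) (s n)
  neg_mem' {φ} ha := by
    filter_upwards [ha] with n h
    simpa using (valueIn_algebraMap (-1 : V) (s n)).mul h
  mem_or_inv_mem' φ := by
    by_cases hφ : φ = 0
    · subst hφ
      exact Or.inl (Eventually.of_forall fun n => by simpa using valueIn_algebraMap (0 : V) (s n))
    have hn := hs.eventually_ne_zero (RatFunc.num_ne_zero hφ)
    have hd := hs.eventually_ne_zero (RatFunc.denom_ne_zero φ)
    refine (hs.eval_le_or_le (RatFunc.num_ne_zero hφ) (RatFunc.denom_ne_zero φ)).imp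
      (fun H => ?_) (fun H => ?_)
    · filter_upwards [H, hd] with n h1 h2 using (valueIn_iff h2).2 h1
    · filter_upwards [H, hn, hd] with n h1 h2 h3 using valueIn_inv h2 h3 h1

theorem algebraMap_mem_VE {s : ℕ → K} (hs : IsPseudoConvergent (ValuationRing.valuation V K) s)
    (a : V) : algebraMap V (RatFunc K) a ∈ VE V s hs := by
  have h : algebraMap V (RatFunc K) a = RatFunc.C (algebraMap V K a) := by
    rw [IsScalarTower.algebraMap_apply V K (RatFunc K), RatFunc.algebraMap_eq_C]
  rw [h]
  exact Eventually.of_forall fun n => valueIn_algebraMap a (s n)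

end Ring

/-- The set `𝒱` of the valuation domains `V_E` in `Zar(K(X)|V)`, where `E` varies among the
pseudo-convergent sequences in `K`; it carries the subspace topology. -/
def spaceV (V : Type u) (K : Type w) [CommRing V] [IsDomain V] [ValuationRing V] [Field K]
    [Algebra V K] [IsFractionRing V K] : Set (Zar V (RatFunc K)) :=
  {W | ∃ (s : ℕ → K) (hs : IsPseudoConvergent (ValuationRing.valuation V K) s), W.1 = VE V s hs}

/-- Every `V_E` is a point of `𝒱`. -/
theorem VE_mem_spaceV {V : Type u} {K : Type w} [CommRing V] [IsDomain V] [ValuationRing V]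
    [Field K] [Algebra V K] [IsFractionRing V K] {s : ℕ → K}
    (hs : IsPseudoConvergent (ValuationRing.valuation V K) s) :
    (⟨VE V s hs, algebraMap_mem_VE hs⟩ : Zar V (RatFunc K)) ∈ spaceV V K :=
  ⟨s, hs, rfl⟩

end PseudoConv

/-! Since `V` is countable, so are `K` and `K(X)`; hence the Zariski topology has a countable
subbasis, and it is T0 because the sets `B(φ)` tell valuation rings apart. With regularity this
gives T3, and Urysohn's theorem gives a metric. The real content is regularity, for which it
suffices to find, around each `V_E` in `B(φ)`, a clopen set inside `B(φ)`
(`exists_isClopen_subset_basicSet`).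

Extend the valuation to `w` on an algebraic closure `L` of `K`, and write `δ n = w (s (n+1) - s n)`,
a strictly decreasing sequence (values are multiplicative: small means close). The sets of `t` with
eventually `w (t n - β) < c`, or eventually `c ≤ w (t n - β)`, are complementary, and both are open,
so they are clopen (`isClopen_setOf_le_val_sub`). Near `s`, the value of a polynomial depends only
on the distances to those of its roots that are pseudo-limits of `s` (`val_eval_on_ball`). At a
point not too close to these roots the distances share one value `y`, so that `φ ∈ V_E` becomes an
inequality `c * y ^ k ≤ c' * y ^ l`, valid on a whole range of `y` (`exists_lower_bound`). -/

namespace PseudoConv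

/-! ### Pseudo-limits and the local behaviour of polynomials. -/

section Limits

variable {L : Type*} [Field L] {Γ : Type*} [LinearOrderedCommGroupWithZero Γ]
  {w : Valuation L Γ} {s : ℕ → L}

/-- `β` is a pseudo-limit of the sequence `s`. -/
def IsPseudoLimit (w : Valuation L Γ) (s : ℕ → L) (β : L) : Prop :=
  ∀ n, w (s n - β) = w (s (n + 1) - s n)

theorem IsPseudoLimit.val_sub_le {β β' : L} (h : IsPseudoLimit w s β) (h' : IsPseudoLimit w s β')
    (n : ℕ) : w (β - β') ≤ w (s (n + 1) - s n) := by
  have e : β - β' = (s n - β') - (s n - β) := by ring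
  rw [e]
  exact (w.map_sub _ _).trans (max_le (h' n).le (h n).le)

/-- Once `δ N < w (s N - β)`, the ultrametric inequality freezes the distance to `β`. If this never
happens, `s n - s (n + 1)` dominates `s (n + 1) - β` for every `n`, so `β` is a pseudo-limit. -/
theorem IsPseudoConvergent.eventually_const (hs : IsPseudoConvergent w s) {β : L}
    (h : ¬ IsPseudoLimit w s β) :
    ∃ ρ : Γ, ∀ᶠ n in atTop, w (s n - β) = ρ ∧ w (s (n + 1) - s n) < ρ := by
  by_cases hN : ∃ N, w (s (N + 1) - s N) < w (s N - β)
  · obtain ⟨N, hN⟩ := hN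
    refine ⟨w (s N - β), ?_⟩
    filter_upwards [eventually_ge_atTop (N + 1)] with n hn
    refine ⟨?_, (hs.strictAnti (show N < n by omega)).trans hN⟩
    obtain ⟨k, rfl⟩ := Nat.exists_eq_add_of_le hn
    have e : s (N + 1 + k) - β = (s (N + 1 + k) - s N) + (s N - β) := by ring
    rw [e, Valuation.map_add_eq_of_lt_right _ (by rwa [hs.val_sub])]
  · push Not at hN
    refine absurd (fun n => ?_) h
    have e : s n - β = (s n - s (n + 1)) + (s (n + 1) - β) := by ring
    have hlt : w (s (n + 1) - β) < w (s n - s (n + 1)) := by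
      rw [Valuation.map_sub_swap w (s n)]
      exact lt_of_le_of_lt (hN (n + 1)) (hs n)
    rw [e, Valuation.map_add_eq_of_lt_left _ hlt, Valuation.map_sub_swap]

theorem IsPseudoConvergent.eventually_gauge_le (hs : IsPseudoConvergent w s) (β : L) :
    ∀ᶠ n in atTop, w (s (n + 1) - s n) ≤ w (s n - β) := by
  by_cases h : IsPseudoLimit w s β
  · exact Eventually.of_forall fun n => (h n).ge
  · obtain ⟨ρ, hρ⟩ := hs.eventually_const h
    filter_upwards [hρ] with n hn
    rw [hn.1]
    exact hn.2.le

theorem IsPseudoConvergent.eventually_le_or_lt (hs : IsPseudoConvergent w s) (β : L) (c : Γ) :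
    (∀ᶠ n in atTop, c ≤ w (s n - β)) ∨ ∀ᶠ n in atTop, w (s n - β) < c := by
  by_cases h : IsPseudoLimit w s β
  · by_cases hN : ∃ N, w (s (N + 1) - s N) < c
    · obtain ⟨N, hN⟩ := hN
      right
      filter_upwards [eventually_ge_atTop N] with n hn
      rw [h n]
      exact (hs.strictAnti.antitone hn).trans_lt hN
    · push Not at hN
      exact Or.inl (Eventually.of_forall fun n => by rw [h n]; exact hN n)
  · obtain ⟨ρ, hρ⟩ := hs.eventually_const h
    rcases le_or_gt c ρ with hc | hc
    · left
      filter_upwards [hρ] with n hn using hn.1 ▸ hc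
    · right
      filter_upwards [hρ] with n hn using hn.1 ▸ hc

theorem IsPseudoConvergent.not_eventually_le_iff (hs : IsPseudoConvergent w s) (β : L) (c : Γ) :
    (¬ ∀ᶠ n in atTop, c ≤ w (s n - β)) ↔ ∀ᶠ n in atTop, w (s n - β) < c := by
  refine ⟨fun h => (hs.eventually_le_or_lt β c).resolve_left h, fun h h' => ?_⟩
  obtain ⟨n, h1, h2⟩ := (h.and h').exists
  exact absurd h1 h2.not_gt

/-- The open ball about `s (N + 1)` of radius `δ N` contains a tail of `s`; these balls serve as
neighbourhoods of `s`. -/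
theorem IsPseudoConvergent.eventually_val_sub_lt (hs : IsPseudoConvergent w s) (N : ℕ) :
    ∀ᶠ n in atTop, w (s n - s (N + 1)) < w (s (N + 1) - s N) := by
  filter_upwards [eventually_ge_atTop (N + 1 + 1)] with n hn
  obtain ⟨k, rfl⟩ := Nat.exists_eq_add_of_le hn
  rw [hs.val_sub]
  exact hs N

theorem IsPseudoConvergent.val_sub_eq_on_ball (hs : IsPseudoConvergent w s) {β : L}
    (h : ¬ IsPseudoLimit w s β) :
    ∃ ρ : Γ, ρ ≠ 0 ∧ ∀ᶠ N in atTop, ∀ x : L, w (x - s (N + 1)) < w (s (N + 1) - s N) →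
      w (x - β) = ρ := by
  obtain ⟨ρ, hρ⟩ := hs.eventually_const h
  refine ⟨ρ, ?_, ?_⟩
  · obtain ⟨n, -, hn⟩ := hρ.exists
    exact (zero_le.trans_lt hn).ne'
  · filter_upwards [hρ, (tendsto_add_atTop_nat 1).eventually hρ] with N h1 h2 x hx
    have e : x - β = (x - s (N + 1)) + (s (N + 1) - β) := by ring
    rw [e, Valuation.map_add_eq_of_lt_right _ (by rw [h2.1]; exact hx.trans h1.2), h2.1]

open Classical in
theorem IsPseudoConvergent.val_prod_on_ball (hs : IsPseudoConvergent w s) (m : Multiset L) :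
    ∃ c : Γ, c ≠ 0 ∧ ∀ᶠ N in atTop, ∀ x : L, w (x - s (N + 1)) < w (s (N + 1) - s N) →
      w ((m.map fun a => x - a).prod) =
        c * ((m.filter (IsPseudoLimit w s)).map fun a => w (x - a)).prod := by
  induction m using Multiset.induction with
  | empty => exact ⟨1, one_ne_zero, by simp⟩
  | cons a m ih =>
    obtain ⟨c, hc, h⟩ := ih
    by_cases ha : IsPseudoLimit w s a
    · refine ⟨c, hc, ?_⟩
      filter_upwards [h] with N h1 x hx
      rw [Multiset.map_cons, Multiset.prod_cons, map_mul, h1 x hx,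
        Multiset.filter_cons_of_pos _ ha, Multiset.map_cons, Multiset.prod_cons, mul_left_comm]
    · obtain ⟨ρ, hρ, h'⟩ := hs.val_sub_eq_on_ball ha
      refine ⟨ρ * c, mul_ne_zero hρ hc, ?_⟩
      filter_upwards [h, h'] with N h1 h2 x hx
      rw [Multiset.map_cons, Multiset.prod_cons, map_mul, h1 x hx, h2 x hx,
        Multiset.filter_cons_of_neg _ ha, mul_assoc]

open Classical in
/-- The roots of `f` that are pseudo-limits of `s`, with multiplicity. -/
noncomputable def limitRoots (w : Valuation L Γ) (s : ℕ → L) (f : L[X]) : Multiset L :=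
  f.roots.filter (IsPseudoLimit w s)

theorem isPseudoLimit_of_mem_limitRoots {f : L[X]} {β : L} (h : β ∈ limitRoots w s f) :
    IsPseudoLimit w s β := by
  classical
  exact (Multiset.mem_filter.1 h).2

/-- Factor `f` over `L`: on a late ball, each root that is not a pseudo-limit lies at a constant
nonzero distance, which is absorbed into `c`. -/
theorem IsPseudoConvergent.val_eval_on_ball [IsAlgClosed L] (hs : IsPseudoConvergent w s)
    {f : L[X]} (hf : f ≠ 0) :
    ∃ c : Γ, c ≠ 0 ∧ ∀ᶠ N in atTop, ∀ x : L, w (x - s (N + 1)) < w (s (N + 1) - s N) →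
      w (f.eval x) = c * ((limitRoots w s f).map fun a => w (x - a)).prod := by
  obtain ⟨c, hc, h⟩ := hs.val_prod_on_ball f.roots
  refine ⟨w f.leadingCoeff * c, mul_ne_zero (by simpa using hf) hc, ?_⟩
  filter_upwards [h] with N hN x hx
  rw [(IsAlgClosed.splits f).eval_eq_prod_roots, map_mul, hN x hx, mul_assoc]
  rfl

theorem exists_pow_eq [IsAlgClosed L] (hw : Function.Surjective w) (γ : Γ) {j : ℕ} (hj : 0 < j) :
    ∃ c : Γ, c ^ j = γ := by
  obtain ⟨x, rfl⟩ := hw γ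
  obtain ⟨z, rfl⟩ := IsAlgClosed.exists_pow_nat_eq x hj
  exact ⟨w z, (map_pow w z j).symm⟩

/-- If `l ≤ k`, the inequality passes from `δ n` to every smaller `y`, and `e = 0` works. If `k <
l`, it holds above `e = (c / c') ^ (1 / (l - k))`, a root that exists because the value group is
divisible; every `δ n` is at least `e`, as the inequality holds at arbitrarily late indices. -/
theorem exists_lower_bound [IsAlgClosed L] (hw : Function.Surjective w) {c c' : Γ}
    (hc' : c' ≠ 0) (k l : ℕ) (hs : IsPseudoConvergent w s)
    (h : ∀ᶠ n in atTop, c * w (s (n + 1) - s n) ^ k ≤ c' * w (s (n + 1) - s n) ^ l) :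
    ∃ e : Γ, (∀ n, e ≤ w (s (n + 1) - s n)) ∧ ∀ᶠ n in atTop, ∀ y : Γ, e ≤ y →
      y ≤ w (s (n + 1) - s n) → c * y ^ k ≤ c' * y ^ l := by
  rcases le_or_gt l k with hkl | hkl
  · refine ⟨0, fun _ => zero_le, ?_⟩
    obtain ⟨j, rfl⟩ := Nat.exists_eq_add_of_le hkl
    filter_upwards [h] with n hn y _ hy
    rw [pow_add, mul_comm (_ ^ l), ← mul_assoc] at hn ⊢
    have h1 := le_of_mul_le_mul_right hn (pow_pos (hs.gauge_pos n) l)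
    refine mul_le_mul_left (le_trans (mul_le_mul_right ?_ c) h1) _
    exact pow_le_pow_left' hy j
  · obtain ⟨j, rfl⟩ := Nat.exists_eq_add_of_le hkl.le
    have hj : 0 < j := by omega
    obtain ⟨e, he⟩ := exists_pow_eq hw (c / c') hj
    have key : ∀ y : Γ, e ≤ y → c * y ^ k ≤ c' * y ^ (k + j) := by
      intro y hy
      have h1 : c / c' ≤ y ^ j := he ▸ pow_le_pow_left' hy j
      rw [div_le_iff₀ (zero_lt_iff.2 hc'), mul_comm] at h1
      rw [pow_add, mul_comm (y ^ k), ← mul_assoc]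
      exact mul_le_mul_left h1 _
    refine ⟨e, fun n => ?_, Eventually.of_forall fun n y hy _ => key y hy⟩
    obtain ⟨N, hN, hnN⟩ := (h.and (eventually_ge_atTop n)).exists
    refine le_trans ?_ (hs.strictAnti.antitone hnN)
    rw [pow_add, mul_comm (_ ^ k) (_ ^ j), ← mul_assoc] at hN
    have h1 := le_of_mul_le_mul_right hN (pow_pos (hs.gauge_pos N) k)
    have h2 : e ^ j ≤ w (s (N + 1) - s N) ^ j := by
      rw [he, div_le_iff₀ (zero_lt_iff.2 hc'), mul_comm]
      exact h1
    exact le_of_pow_le_pow_left₀ hj.ne' zero_le h2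

end Limits

/-! ### Values in an algebraic extension. -/

section Powers

variable {K L : Type*} [Field K] [Field L] [Algebra K L] [Algebra.IsAlgebraic K L]
  {Γ : Type*} [LinearOrderedCommGroupWithZero Γ]

/-- The value group of an algebraic extension is torsion over that of the base field. -/
theorem exists_val_pow_eq (w : Valuation L Γ) {x : L} (hx : x ≠ 0) :
    ∃ b : K, b ≠ 0 ∧ ∃ M : ℕ, 0 < M ∧ w x ^ M = w (algebraMap K L b) := by
  obtain ⟨p, hp, hpx⟩ := Algebra.IsAlgebraic.isAlgebraic (R := K) x
  obtain ⟨i, hi, hmax⟩ := p.support.exists_max_image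
    (fun i => w (algebraMap K L (p.coeff i) * x ^ i)) (by simpa using hp)
  have hsum : ∑ i ∈ p.support, algebraMap K L (p.coeff i) * x ^ i = 0 := by
    rw [← hpx, Polynomial.aeval_eq_sum_range, ← Finset.sum_subset p.supp_subset_range_natDegree_succ]
    · simp [Algebra.smul_def]
    · intro k _ hk
      simp [Polynomial.notMem_support_iff.1 hk]
  have hne : ∀ k ∈ p.support, w (algebraMap K L (p.coeff k)) ≠ 0 := fun k hk => by
    simpa using hk
  have hx' : w x ≠ 0 := by simpa using hx
  -- The terms sum to zero, so the maximal value cannot be attained only once; two tied terms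
  -- express a power of `w x` as a value from `K`.
  obtain ⟨j, hj, hji, hij⟩ : ∃ j ∈ p.support, j ≠ i ∧
      w (algebraMap K L (p.coeff i) * x ^ i) = w (algebraMap K L (p.coeff j) * x ^ j) := by
    by_contra! H
    have := w.map_sum_eq_of_lt hi (f := fun i => algebraMap K L (p.coeff i) * x ^ i) fun k hk => by
      rw [Finset.mem_sdiff, Finset.mem_singleton] at hk
      exact lt_of_le_of_ne (hmax k hk.1) (H k hk.1 hk.2).symm
    rw [hsum, map_zero, map_mul, map_pow] at this
    exact mul_ne_zero (hne i hi) (pow_ne_zero _ hx') this.symm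
  have key : ∀ i j : ℕ, i ∈ p.support → j ∈ p.support → i < j →
      w (algebraMap K L (p.coeff i) * x ^ i) = w (algebraMap K L (p.coeff j) * x ^ j) →
      ∃ b : K, b ≠ 0 ∧ ∃ M : ℕ, 0 < M ∧ w x ^ M = w (algebraMap K L b) := by
    intro i j hi hj hij h
    obtain ⟨d, rfl⟩ := Nat.exists_eq_add_of_lt hij
    have hi' := hne i hi
    have hj' := hne _ hj
    rw [Polynomial.mem_support_iff] at hi hj
    refine ⟨p.coeff i / p.coeff (i + d + 1), div_ne_zero hi hj, d + 1, d.succ_pos, ?_⟩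
    rw [map_div₀, map_div₀, eq_div_iff hj']
    simp only [map_mul, map_pow] at h
    rw [add_assoc, pow_add, mul_comm (w x ^ i), ← mul_assoc] at h
    have := mul_right_cancel₀ (pow_ne_zero i hx') h
    rw [this, mul_comm, add_assoc]
  rcases lt_or_gt_of_ne hji with h | h
  · exact key j i hj hi h hij.symm
  · exact key i j hi hj h hij

end Powers

theorem prod_map_lt_pow {α : Type*} {Γ : Type*} [LinearOrderedCommGroupWithZero Γ]
    {m : Multiset α} {f : α → Γ} {c : Γ} (hle : ∀ a ∈ m, f a ≤ c) {b : α}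
    (hb : b ∈ m) (hlt : f b < c) : (m.map f).prod < c ^ m.card := by
  obtain ⟨m', rfl⟩ := Multiset.exists_cons_of_mem hb
  have hc : 0 < c := zero_le.trans_lt hlt
  have h : (m'.map f).prod ≤ c ^ m'.card := by
    have := Multiset.prod_le_pow_card (m'.map f) c (by
      intro x hx
      obtain ⟨a, ha, rfl⟩ := Multiset.mem_map.1 hx
      exact hle a (Multiset.mem_cons_of_mem ha))
    simpa using this
  rw [Multiset.map_cons, Multiset.prod_cons, Multiset.card_cons, pow_succ']
  calc f b * (m'.map f).prod ≤ f b * c ^ m'.card := mul_le_mul_right h _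
    _ < c * c ^ m'.card := mul_lt_mul_of_pos_right hlt (pow_pos hc _)

/-! ### The topology of `𝒱`, read on pseudo-convergent sequences. -/

section Space

open Topology

universe u w

variable (V : Type u) (K : Type w) [CommRing V] [IsDomain V] [ValuationRing V] [Field K]
  [Algebra V K] [IsFractionRing V K]

/-- The pseudo-convergent sequences in `K`. -/
def PCSeq : Type w :=
  {s : ℕ → K // IsPseudoConvergent (ValuationRing.valuation V K) s}

variable {V K}

/-- The point `V_E` of `𝒱` attached to the pseudo-convergent sequence `E`. -/
noncomputable def PCSeq.toSpaceV (s : PCSeq V K) : spaceV V K :=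
  ⟨⟨VE V s.1 s.2, algebraMap_mem_VE s.2⟩, VE_mem_spaceV s.2⟩

theorem PCSeq.toSpaceV_surjective : Function.Surjective (PCSeq.toSpaceV (V := V) (K := K)) := by
  rintro ⟨⟨W, hW⟩, s, hs, h⟩
  exact ⟨⟨s, hs⟩, Subtype.ext (Subtype.ext h.symm)⟩

/-- The topology induced by the Zariski topology of `𝒱`. -/
noncomputable instance : TopologicalSpace (PCSeq V K) :=
  TopologicalSpace.induced PCSeq.toSpaceV inferInstance

/-- The set of the pseudo-convergent sequences `E` with `φ ∈ V_E`. -/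
def basicSet (φ : RatFunc K) : Set (PCSeq V K) :=
  {s | φ ∈ VE V s.1 s.2}

theorem spaceV_topology_eq : (inferInstance : TopologicalSpace (spaceV V K)) =
    TopologicalSpace.generateFrom
      (Set.range fun φ : RatFunc K => {W : spaceV V K | φ ∈ W.1.1}) := by
  change TopologicalSpace.induced _ (TopologicalSpace.generateFrom _) = _
  rw [induced_generateFrom_eq, ← Set.range_comp]
  rfl

theorem PCSeq.topology_eq : (inferInstance : TopologicalSpace (PCSeq V K)) =
    TopologicalSpace.generateFrom (Set.range (basicSet (V := V) (K := K))) := by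
  change TopologicalSpace.induced _ inferInstance = _
  rw [spaceV_topology_eq, induced_generateFrom_eq, ← Set.range_comp]
  rfl

theorem isOpen_basicSet (φ : RatFunc K) : IsOpen (basicSet (V := V) φ) := by
  refine ⟨{W | φ ∈ W.1.1}, ⟨{W | φ ∈ W.1}, ?_, rfl⟩, rfl⟩
  exact TopologicalSpace.isOpen_generateFrom_of_mem ⟨φ, rfl⟩

theorem mem_basicSet_iff {φ : RatFunc K} {s : PCSeq V K} :
    s ∈ basicSet φ ↔ ∀ᶠ n in atTop, ValuationRing.valuation V K (φ.num.eval (s.1 n)) ≤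
      ValuationRing.valuation V K (φ.denom.eval (s.1 n)) :=
  eventually_congr <| (s.2.eventually_ne_zero (RatFunc.denom_ne_zero φ)).mono
    fun _ hn => valueIn_iff hn

/-- The fraction need not be reduced: cancelling common factors is harmless where `g` and the
reduced denominator do not vanish, hence eventually along `s`. -/
theorem mem_basicSet_div_iff {f g : K[X]} (hg : g ≠ 0) {s : PCSeq V K} :
    s ∈ basicSet (algebraMap K[X] (RatFunc K) f / algebraMap K[X] (RatFunc K) g) ↔
      ∀ᶠ n in atTop, ValuationRing.valuation V K (f.eval (s.1 n)) ≤
        ValuationRing.valuation V K (g.eval (s.1 n)) := by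
  rw [mem_basicSet_iff]
  refine eventually_congr ?_
  filter_upwards [s.2.eventually_ne_zero hg, s.2.eventually_ne_zero
    (RatFunc.denom_ne_zero (algebraMap K[X] (RatFunc K) f / algebraMap K[X] (RatFunc K) g))]
    with n h1 h2
  have h := congrArg (fun p : K[X] => ValuationRing.valuation V K (p.eval (s.1 n)))
    ((RatFunc.num_mul_eq_mul_denom_iff hg).2 rfl :
      (algebraMap K[X] (RatFunc K) f / algebraMap K[X] (RatFunc K) g).num * g = f * _)
  simp only [Polynomial.eval_mul, map_mul] at h
  have h1' := (Valuation.ne_zero_iff (ValuationRing.valuation V K)).2 h1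
  have h2' := (Valuation.ne_zero_iff (ValuationRing.valuation V K)).2 h2
  rw [← div_le_one₀ (zero_lt_iff.2 h1'), ← div_le_one₀ (zero_lt_iff.2 h2'),
    (div_eq_div_iff h2' h1').2 h]

/-! ### Clopen sets defined by distances to points of an extension field. -/

variable {L : Type*} [Field L] [Algebra K L] {Γ : Type*} [LinearOrderedCommGroupWithZero Γ]
  {w : Valuation L Γ}

/-- `w` prolongs the valuation of `V`. -/
def Extends (V : Type u) {K : Type w} [CommRing V] [IsDomain V] [ValuationRing V] [Field K]
    [Algebra V K] [IsFractionRing V K] {L : Type*} [Field L] [Algebra K L]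
    {Γ : Type*} [LinearOrderedCommGroupWithZero Γ] (w : Valuation L Γ) : Prop :=
  ∀ x y : K, ValuationRing.valuation V K x ≤ ValuationRing.valuation V K y ↔
    w (algebraMap K L x) ≤ w (algebraMap K L y)

/-- The sequence `s`, seen in the extension `L` of `K`. -/
def PCSeq.lift (L : Type*) [Field L] [Algebra K L] (s : PCSeq V K) (n : ℕ) : L :=
  algebraMap K L (s.1 n)

theorem PCSeq.isPseudoConvergent_lift (hw : Extends V (K := K) w) (s : PCSeq V K) :
    IsPseudoConvergent w (s.lift L) := by
  intro n
  have := s.2 n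
  rw [← not_le, hw, not_le] at this
  simpa only [map_sub, PCSeq.lift] using this

theorem isOpen_setOf_eval_le (hw : Extends V (K := K) w) (f : K[X]) {g : K[X]} (hg : g ≠ 0) :
    IsOpen {s : PCSeq V K | ∀ᶠ n in atTop, w ((f.map (algebraMap K L)).eval (s.lift L n)) ≤
      w ((g.map (algebraMap K L)).eval (s.lift L n))} := by
  convert isOpen_basicSet (V := V)
    (algebraMap K[X] (RatFunc K) f / algebraMap K[X] (RatFunc K) g) using 1
  ext s
  rw [mem_basicSet_div_iff hg]
  simp only [PCSeq.lift, Set.mem_ofPred_eq, Polynomial.eval_map_apply, hw _ _]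

/-- The centre `β` may lie outside `K`, so it is replaced by `s N`: the closed ball about `s N` of
radius `δ N ≤ w (s N - β) < c` is defined over `K` and stays within distance `c` of `β`. -/
theorem isOpen_setOf_val_sub_lt (hw : Extends V (K := K) w) (β : L) (c : Γ) :
    IsOpen {s : PCSeq V K | ∀ᶠ n in atTop, w (s.lift L n - β) < c} := by
  rw [isOpen_iff_mem_nhds]
  intro s hs
  have hpc := s.isPseudoConvergent_lift hw
  obtain ⟨N, h1, h2⟩ := (hs.and (hpc.eventually_gauge_le β)).exists
  have ho := isOpen_setOf_eval_le (V := V) hw (X - C (s.1 N)) (g := C (s.1 (N + 1) - s.1 N)) (by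
    have := hpc.gauge_pos N
    rw [ne_eq, Polynomial.C_eq_zero]
    intro h
    simp [PCSeq.lift, ← map_sub, h] at this)
  refine mem_of_superset (ho.mem_nhds ?_) ?_
  · filter_upwards [eventually_ge_atTop (N + 1)] with n hn
    obtain ⟨k, rfl⟩ := Nat.exists_eq_add_of_le hn
    simpa [PCSeq.lift] using (hpc.val_sub N k).le
  · intro t ht
    filter_upwards [ht] with n hn
    have e : t.lift L n - β = (t.lift L n - s.lift L N) + (s.lift L N - β) := by ring
    rw [e]
    refine w.map_add_lt (lt_of_le_of_lt ?_ (h2.trans_lt h1)) h1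
    simpa [PCSeq.lift] using hn

variable [IsAlgClosed L]

theorem isOpen_setOf_le_val_sub [Algebra.IsAlgebraic K L] (hw : Extends V (K := K) w)
    (hsurj : Function.Surjective w) (β : L) (c : Γ) :
    IsOpen {s : PCSeq V K | ∀ᶠ n in atTop, c ≤ w (s.lift L n - β)} := by
  rcases eq_or_ne c 0 with rfl | hc
  · simp
  rw [isOpen_iff_mem_nhds]
  intro s hs
  have hpc := s.isPseudoConvergent_lift hw
  by_cases hβ : IsPseudoLimit w (s.lift L) β
  · obtain ⟨f, hf0, hfβ⟩ := Algebra.IsAlgebraic.isAlgebraic (R := K) β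
    have hf0' : f.map (algebraMap K L) ≠ 0 :=
      (Polynomial.map_ne_zero_iff (algebraMap K L).injective).2 hf0
    obtain ⟨a, ha, hball⟩ := hpc.val_eval_on_ball hf0'
    set m := limitRoots w (s.lift L) (f.map (algebraMap K L)) with hm
    have hβm : β ∈ m := by
      classical
      refine Multiset.mem_filter.2 ⟨?_, hβ⟩
      rw [Polynomial.mem_roots hf0', Polynomial.IsRoot, Polynomial.eval_map_algebraMap, hfβ]
    -- Enlarge `c` until all the limit roots lie within `c'` of `β`; pseudo-limits are so close to
    -- each other that every `δ n` is still at least `c'`.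
    obtain ⟨c', hcc', hc's, hc'⟩ : ∃ c', c ≤ c' ∧
        (∀ n, c' ≤ w (s.lift L (n + 1) - s.lift L n)) ∧ ∀ a ∈ m, w (β - a) ≤ c' := by
      classical
      obtain ⟨b, hb, hmax⟩ := m.toFinset.exists_max_image (fun a => w (β - a))
        ⟨β, Multiset.mem_toFinset.2 hβm⟩
      refine ⟨max c (w (β - b)), le_max_left _ _, fun n => max_le ?_ ?_, fun a ha => ?_⟩
      · obtain ⟨n', h1, h2⟩ := (hs.and (eventually_ge_atTop n)).exists
        rw [hβ n'] at h1
        exact h1.trans (hpc.strictAnti.antitone h2)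
      · exact hβ.val_sub_le (isPseudoLimit_of_mem_limitRoots (Multiset.mem_toFinset.1 hb)) n
      · exact (hmax a (Multiset.mem_toFinset.2 ha)).trans (le_max_right _ _)
    have hc'0 : c' ≠ 0 := fun h => hc (le_zero_iff.1 (h ▸ hcc'))
    obtain ⟨x, hx⟩ := hsurj (a * c' ^ m.card)
    have hx0 : x ≠ 0 := by
      rw [← w.ne_zero_iff, hx]
      exact mul_ne_zero ha (pow_ne_zero _ hc'0)
    -- The threshold `a * c' ^ m.card` need not be a value from `K`, but its `M`-th power is;
    -- comparing `C b` with `f ^ M` therefore gives an open condition over `K`.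
    obtain ⟨b, -, M, hM, hbM⟩ := exists_val_pow_eq (K := K) w hx0
    rw [hx] at hbM
    obtain ⟨N, hN⟩ := hball.exists
    have ho := isOpen_setOf_eval_le (V := V) hw (C b) (pow_ne_zero M hf0)
    have ho' := isOpen_setOf_val_sub_lt (V := V) hw (s.lift L (N + 1))
      (w (s.lift L (N + 1) - s.lift L N))
    refine mem_of_superset (inter_mem (ho.mem_nhds ?_)
      (ho'.mem_nhds (hpc.eventually_val_sub_lt N))) ?_
    · filter_upwards [hpc.eventually_val_sub_lt N] with n hn
      rw [Polynomial.map_C, Polynomial.eval_C, ← hbM, Polynomial.map_pow, Polynomial.eval_pow,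
        map_pow, hN _ hn]
      refine pow_le_pow_left' (mul_le_mul_right ?_ a) M
      rw [← Multiset.prod_replicate, ← Multiset.map_const']
      refine Multiset.prod_map_le_prod_map₀ _ _ (fun _ _ => zero_le) fun a ha => ?_
      rw [isPseudoLimit_of_mem_limitRoots ha n]
      exact hc's n
    · rintro t ⟨ht, ht'⟩
      -- If `t n` were closer to `β` than `c`, every factor would be at most `c'` and the one at `β`
      -- strictly smaller, so the product would fall below `c' ^ m.card`.
      by_contra hcon
      rw [Set.mem_ofPred_eq, (t.isPseudoConvergent_lift hw).not_eventually_le_iff] at hcon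
      obtain ⟨n, h1, h2, h3⟩ := (ht.and (ht'.and hcon)).exists
      rw [Polynomial.map_C, Polynomial.eval_C, ← hbM, Polynomial.map_pow, Polynomial.eval_pow,
        map_pow, hN _ h2] at h1
      have h4 := le_of_mul_le_mul_left (le_of_pow_le_pow_left₀ hM.ne' zero_le h1)
        (zero_lt_iff.2 ha)
      refine absurd (prod_map_lt_pow (fun a ha => ?_) hβm (h3.trans_le hcc')) h4.not_gt
      have e : t.lift L n - a = (t.lift L n - β) + (β - a) := by ring
      rw [e]
      exact w.map_add_le (h3.le.trans hcc') (hc' a ha)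
  -- When `β` is not a pseudo-limit, its distance is constant on a whole ball around the tail of
  -- `s`.
  · obtain ⟨ρ, -, hρ⟩ := hpc.val_sub_eq_on_ball hβ
    obtain ⟨N, hN⟩ := hρ.exists
    obtain ⟨n, h1, h2⟩ := (hs.and (hpc.eventually_val_sub_lt N)).exists
    refine mem_of_superset ((isOpen_setOf_val_sub_lt (V := V) hw (s.lift L (N + 1))
      (w (s.lift L (N + 1) - s.lift L N))).mem_nhds (hpc.eventually_val_sub_lt N)) ?_
    intro t ht
    filter_upwards [ht] with n' hn'
    rw [hN _ hn', ← hN _ h2]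
    exact h1

theorem isClopen_setOf_le_val_sub [Algebra.IsAlgebraic K L] (hw : Extends V (K := K) w)
    (hsurj : Function.Surjective w) (β : L) (c : Γ) :
    IsClopen {s : PCSeq V K | ∀ᶠ n in atTop, c ≤ w (s.lift L n - β)} := by
  refine ⟨⟨?_⟩, isOpen_setOf_le_val_sub hw hsurj β c⟩
  convert isOpen_setOf_val_sub_lt (V := V) hw β c using 1
  ext s
  exact (s.isPseudoConvergent_lift hw).not_eventually_le_iff β c

theorem isClopen_setOf_val_sub_lt [Algebra.IsAlgebraic K L] (hw : Extends V (K := K) w)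
    (hsurj : Function.Surjective w) (β : L) (c : Γ) :
    IsClopen {s : PCSeq V K | ∀ᶠ n in atTop, w (s.lift L n - β) < c} := by
  convert (isClopen_setOf_le_val_sub (V := V) hw hsurj β c).compl using 1
  ext s
  exact ((s.isPseudoConvergent_lift hw).not_eventually_le_iff β c).symm

theorem exists_isClopen_subset_basicSet [Algebra.IsAlgebraic K L] (hw : Extends V (K := K) w)
    (hsurj : Function.Surjective w) {φ : RatFunc K} (hφ : φ ≠ 0) {s : PCSeq V K}
    (hs : s ∈ basicSet φ) : ∃ U : Set (PCSeq V K), IsClopen U ∧ s ∈ U ∧ U ⊆ basicSet φ := by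
  classical
  have hpc := s.isPseudoConvergent_lift hw
  have hinj := (algebraMap K L).injective
  have hmem : ∀ t : PCSeq V K, t ∈ basicSet φ ↔ ∀ᶠ n in atTop,
      w ((φ.num.map (algebraMap K L)).eval (t.lift L n)) ≤
        w ((φ.denom.map (algebraMap K L)).eval (t.lift L n)) := fun t => by
    rw [mem_basicSet_iff]
    simp only [PCSeq.lift, Polynomial.eval_map_apply, hw _ _]
  obtain ⟨c, hc, hf⟩ := hpc.val_eval_on_ball
    ((Polynomial.map_ne_zero_iff hinj).2 (RatFunc.num_ne_zero hφ))
  obtain ⟨c', hc', hg⟩ := hpc.val_eval_on_ball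
    ((Polynomial.map_ne_zero_iff hinj).2 (RatFunc.denom_ne_zero φ))
  set m := limitRoots w (s.lift L) (φ.num.map (algebraMap K L))
  set m' := limitRoots w (s.lift L) (φ.denom.map (algebraMap K L))
  have hlim : ∀ a ∈ m + m', IsPseudoLimit w (s.lift L) a := fun a ha => by
    rcases Multiset.mem_add.1 ha with h | h <;> exact isPseudoLimit_of_mem_limitRoots h
  have hprod : ∀ (x : L) (y : Γ) (q : Multiset L), (∀ a ∈ q, w (x - a) = y) →
      (q.map fun a => w (x - a)).prod = y ^ q.card := fun x y q h => by
    rw [Multiset.map_congr rfl h, Multiset.map_const', Multiset.prod_replicate]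
  have hle : ∀ᶠ n in atTop, c * w (s.lift L (n + 1) - s.lift L n) ^ m.card ≤
      c' * w (s.lift L (n + 1) - s.lift L n) ^ m'.card := by
    obtain ⟨N, hfN, hgN⟩ := (hf.and hg).exists
    filter_upwards [hpc.eventually_val_sub_lt N, (hmem s).1 hs] with n h1 h2
    rwa [hfN _ h1, hgN _ h1,
      hprod _ _ m fun a ha => hlim a (Multiset.mem_add.2 (Or.inl ha)) n,
      hprod _ _ m' fun a ha => hlim a (Multiset.mem_add.2 (Or.inr ha)) n] at h2
  obtain ⟨e, he, hy⟩ := exists_lower_bound hsurj hc' m.card m'.card hpc hle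
  -- Points at distance at least `e'` from all the limit roots are equidistant from them, and `s`
  -- itself satisfies this condition.
  obtain ⟨e', hee', he's, he'⟩ : ∃ e', e ≤ e' ∧
      (∀ n, e' ≤ w (s.lift L (n + 1) - s.lift L n)) ∧
      ∀ a ∈ m + m', ∀ b ∈ m + m', w (a - b) ≤ e' := by
    let A := (m + m').toFinset ×ˢ (m + m').toFinset
    refine ⟨max e (A.sup fun p => w (p.1 - p.2)), le_max_left _ _, fun n => max_le (he n) ?_,
      fun a ha b hb => ?_⟩
    · refine Finset.sup_le fun p hp => ?_
      obtain ⟨h1, h2⟩ := Finset.mem_product.1 hp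
      exact (hlim _ (Multiset.mem_toFinset.1 h1)).val_sub_le (hlim _ (Multiset.mem_toFinset.1 h2)) n
    · exact le_trans (Finset.le_sup (f := fun p : L × L => w (p.1 - p.2)) (b := (a, b))
        (Finset.mem_product.2 ⟨Multiset.mem_toFinset.2 ha, Multiset.mem_toFinset.2 hb⟩))
        (le_max_right _ _)
  obtain ⟨N, hfN, hgN, hyN⟩ := (hf.and (hg.and hy)).exists
  refine ⟨{t | ∀ᶠ n in atTop, w (t.lift L n - s.lift L (N + 1)) <
      w (s.lift L (N + 1) - s.lift L N)} ∩
    ⋂ a ∈ (m + m').toFinset, {t | ∀ᶠ n in atTop, e' ≤ w (t.lift L n - a)},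
    (isClopen_setOf_val_sub_lt hw hsurj _ _).inter
      (isClopen_biInter_finset fun a _ => isClopen_setOf_le_val_sub hw hsurj a e'),
    ⟨hpc.eventually_val_sub_lt N, ?_⟩, ?_⟩
  · simp only [Set.mem_iInter, Multiset.mem_toFinset]
    intro a ha
    refine Eventually.of_forall fun n => ?_
    rw [hlim a ha n]
    exact he's n
  · rintro t ⟨ht, ht'⟩
    simp only [Set.mem_iInter, Set.mem_ofPred_eq] at ht'
    rw [hmem]
    filter_upwards [ht, (Filter.eventually_all_finset _).2 ht'] with n h1 h2
    simp only [Multiset.mem_toFinset] at h2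
    rw [hfN _ h1, hgN _ h1]
    obtain ⟨y, hey, hyd, hym⟩ : ∃ y, e ≤ y ∧ y ≤ w (s.lift L (N + 1) - s.lift L N) ∧
        ∀ a ∈ m + m', w (t.lift L n - a) = y := by
      by_cases hne : ∃ b, b ∈ m + m'
      · obtain ⟨b, hb⟩ := hne
        have key : ∀ a ∈ m + m', ∀ a' ∈ m + m', w (t.lift L n - a) ≤ w (t.lift L n - a') := by
          intro a ha a' ha'
          have e : t.lift L n - a = (t.lift L n - a') + (a' - a) := by ring
          rw [e]
          exact w.map_add_le le_rfl ((he' a' ha' a ha).trans (h2 a' ha'))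
        refine ⟨w (t.lift L n - b), hee'.trans (h2 b hb), ?_,
          fun a ha => le_antisymm (key a ha b hb) (key b hb a ha)⟩
        have e : t.lift L n - b = (t.lift L n - s.lift L (N + 1)) + (s.lift L (N + 1) - b) := by
          ring
        rw [e]
        refine w.map_add_le h1.le ?_
        rw [hlim b hb (N + 1)]
        exact (hpc N).le
      · push Not at hne
        -- Without limit roots both sides are constant, and `y = δ N` is just an admissible choice.
        exact ⟨_, he N, le_rfl, fun a ha => absurd ha (hne a)⟩
    rw [hprod _ y m fun a ha => hym a (Multiset.mem_add.2 (Or.inl ha)),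
      hprod _ y m' fun a ha => hym a (Multiset.mem_add.2 (Or.inr ha))]
    exact hyN y hey hyd

end Space

/-! ### Regularity, T0 and countability. -/

section Separation

open Topology

universe u w

variable {V : Type u} {K : Type w} [CommRing V] [IsDomain V] [ValuationRing V] [Field K]
  [Algebra V K] [IsFractionRing V K]

instance : RegularSpace (PCSeq V K) := by
  obtain ⟨W, hW⟩ := exists_extension V (K := K) (AlgebraicClosure K)
  rw [regularSpace_generateFrom PCSeq.topology_eq]
  rintro _ ⟨φ, rfl⟩ s hs
  obtain ⟨U, hU, hsU, hUφ⟩ : ∃ U : Set (PCSeq V K), IsClopen U ∧ s ∈ U ∧ U ⊆ basicSet φ := by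
    by_cases hφ : φ = 0
    · exact ⟨Set.univ, isClopen_univ, Set.mem_univ _, fun t _ => hφ ▸ zero_mem (VE V t.1 t.2)⟩
    · exact exists_isClopen_subset_basicSet (w := W.valuation) hW W.valuation_surjective hφ hs
  refine Filter.disjoint_iff.2 ⟨Uᶜ, ?_, U, hU.isOpen.mem_nhds hsU, disjoint_compl_left⟩
  exact hU.compl.isOpen.mem_nhdsSet.2 (Set.compl_subset_compl.2 hUφ)

instance : RegularSpace (spaceV V K) := by
  have hf : IsInducing (PCSeq.toSpaceV (V := V) (K := K)) := ⟨rfl⟩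
  -- A section of an inducing map is inducing, so `𝒱` inherits regularity from the space of
  -- sequences.
  obtain ⟨g, hg⟩ := PCSeq.toSpaceV_surjective (V := V) (K := K).hasRightInverse
  have : IsInducing g := by
    rw [← hf.of_comp_iff, hg.comp_eq_id]
    exact IsInducing.id
  exact this.regularSpace

instance (D : Type u) (L : Type w) [CommRing D] [Field L] [Algebra D L] : T0Space (Zar D L) := by
  refine ⟨fun W W' h => Subtype.ext (SetLike.ext fun φ => ?_)⟩
  exact h.mem_open_iff (TopologicalSpace.isOpen_generateFrom_of_mem ⟨φ, rfl⟩)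

theorem secondCountableTopology_zar (D : Type u) (L : Type w) [CommRing D] [Field L] [Algebra D L]
    [Countable L] : SecondCountableTopology (Zar D L) :=
  ⟨_, Set.countable_range _, rfl⟩

theorem countable_ratFunc (K : Type*) [Field K] [Countable K] : Countable (RatFunc K) := by
  have : Countable K[X] := by
    rw [← Cardinal.mk_le_aleph0_iff]
    exact Polynomial.cardinalMk_le_max.trans (max_le Cardinal.mk_le_aleph0 le_rfl)
  exact Function.Injective.countable (f := fun φ : RatFunc K => (φ.num, φ.denom)) fun φ ψ h => by
    obtain ⟨h1, h2⟩ := Prod.ext_iff.1 h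
    dsimp only at h1 h2
    rw [← RatFunc.num_div_denom φ, ← RatFunc.num_div_denom ψ, h1, h2]

end Separation

end PseudoConv

theorem corollary6p13 {V : Type*} {K : Type*} [CommRing V] [IsDomain V] [ValuationRing V]
    [Field K] [Algebra V K] [IsFractionRing V K]
    (hrank : ringKrullDim V = 1) (hV : Countable V) :
    SecondCountableTopology (PseudoConv.spaceV V K) ∧
      T3Space (PseudoConv.spaceV V K) ∧
      TopologicalSpace.MetrizableSpace (PseudoConv.spaceV V K) := by
  have : Countable K := by
    refine Function.Surjective.countable (f := fun p : V × V =>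
      algebraMap V K p.1 / algebraMap V K p.2) fun x => ?_
    obtain ⟨a, b, -, h⟩ := IsFractionRing.div_surjective (A := V) x
    exact ⟨(a, b), h⟩
  have := PseudoConv.countable_ratFunc K
  have := PseudoConv.secondCountableTopology_zar V (RatFunc K)
  have h3 : T3Space (PseudoConv.spaceV V K) := {}
  exact ⟨inferInstance, h3, TopologicalSpace.metrizableSpace_of_t3_secondCountable _⟩
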